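/- Let $R$ be a commutative semilocal ring (i.e. $R$ has finitely many maximal ideals) and let $A$ be an Azumaya $R$-algebra. For a finitely generated projective $R$-module $M$, let $\operatorname{rank}_R M:\operatorname{Spec} R\to\mathbb{Z}_{\ge 0}$ denote its rank function. For an Azumaya $R$-algebra $B$ put $\deg B=\sqrt{\operatorname{rank}_R B}$, and let $[B]$ denote its Brauer class: Azumaya $R$-algebras $B,B'$ are Brauer-equivalent if $B\otimes_R\operatorname{End}_R(P)\cong B'\otimes_R\operatorname{End}_R(Q)$ as $R$-algebras for some finitely generated faithful projective $R$-modules $P,Q$. Let $\operatorname{ind} A=\gcd\{\deg A' : A'\in[A]\}$, where the gcd is taken pointwise on $\operatorname{Spec} R$, and for a finitely generated projective right $A$-module $P$ let $\operatorname{rrk}_A P=\operatorname{rank}_R P/\deg A$ be its reduced rank. Then there exists an idempotent $e\in A$ which is full (that is, $AeA=A$) such that $eAe$ is an Azumaya $R$-algebra that is Brauer-equivalent to $A$, and $$\operatorname{rrk}_A eA=\deg eAe=\operatorname{ind} A$$ as functions on $\operatorname{Spec} R$. -/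

import Mathlib

open scoped TensorProduct

universe u v w

namespace AzumayaIndex

section Corner

variable {R : Type u} {A : Type v} [CommRing R] [Ring A] [Algebra R A] {e : A}

/-- `R` acts on the corner ring `eAe` by restriction of its action on `A`. -/
instance cornerSMul (he : IsIdempotentElem e) : SMul R he.Corner where
  smul r x := ⟨r • x.1, by
    obtain ⟨a, ha⟩ := x.2
    exact ⟨r • a, by simp [← ha]⟩⟩

theorem corner_coe_smul (he : IsIdempotentElem e) (r : R) (x : he.Corner) :
    (r • x).1 = r • x.1 := rfl

theorem corner_coe_mul (he : IsIdempotentElem e) (x y : he.Corner) :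
    (x * y).1 = x.1 * y.1 := rfl

theorem corner_coe_add (he : IsIdempotentElem e) (x y : he.Corner) :
    (x + y).1 = x.1 + y.1 := rfl

theorem corner_coe_zero (he : IsIdempotentElem e) : (0 : he.Corner).1 = 0 := rfl

theorem corner_coe_one (he : IsIdempotentElem e) : (1 : he.Corner).1 = e := rfl

instance cornerModule (he : IsIdempotentElem e) : Module R he.Corner where
  one_smul x := Subtype.ext (by rw [corner_coe_smul, one_smul])
  mul_smul r s x := Subtype.ext (by simp only [corner_coe_smul, mul_smul])
  smul_zero r := Subtype.ext (by rw [corner_coe_smul, corner_coe_zero, smul_zero])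
  smul_add r x y := Subtype.ext (by simp only [corner_coe_smul, corner_coe_add, smul_add])
  add_smul r s x := Subtype.ext (by simp only [corner_coe_smul, corner_coe_add, add_smul])
  zero_smul x := Subtype.ext (by rw [corner_coe_smul, corner_coe_zero, zero_smul])

/-- The corner ring `eAe` (with unit `e`) as an `R`-algebra. -/
instance cornerAlgebra (he : IsIdempotentElem e) : Algebra R he.Corner :=
  Algebra.ofModule
    (fun r x y => Subtype.ext (by simp only [corner_coe_smul, corner_coe_mul, smul_mul_assoc]))
    (fun r x y => Subtype.ext (by simp only [corner_coe_smul, corner_coe_mul, mul_smul_comm]))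

end Corner

/-- The idempotent `e` is full: `AeA = A`, that is, the two-sided ideal
generated by `e` is all of `A`. -/
def IsFull {A : Type v} [Ring A] (e : A) : Prop :=
  TwoSidedIdeal.span {e} = ⊤

/-- The right ideal `eA`, as a right `A`-module, i.e. an `Aᵐᵒᵖ`-submodule of `A`. -/
def rightIdeal {A : Type v} [Ring A] (e : A) : Submodule Aᵐᵒᵖ A :=
  Submodule.span Aᵐᵒᵖ {e}

/-- Brauer equivalence of (Azumaya) `R`-algebras: `A ⊗ End_R(P) ≃ B ⊗ End_R(Q)` as `R`-algebras
for some finitely generated faithful projective `R`-modules `P` and `Q`. Up to isomorphism, all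
finitely generated `R`-modules live in the universe of `R`. -/
def BrauerEquiv (R : Type u) [CommRing R] (A : Type v) [Ring A] [Algebra R A]
    (B : Type w) [Ring B] [Algebra R B] : Prop :=
  ∃ (P Q : Type u) (_ : AddCommGroup P) (_ : Module R P) (_ : AddCommGroup Q) (_ : Module R Q),
    Module.Finite R P ∧ Module.Projective R P ∧ FaithfulSMul R P ∧
    Module.Finite R Q ∧ Module.Projective R Q ∧ FaithfulSMul R Q ∧
    Nonempty ((A ⊗[R] Module.End R P) ≃ₐ[R] (B ⊗[R] Module.End R Q))

/-- The degree of an Azumaya `R`-algebra: the function `√(rank_R A)` on `Spec R`. (The rank of an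
Azumaya algebra is a perfect square at every prime, so the integer square root is exact.) -/
noncomputable def degree (R : Type u) [CommRing R] (A : Type v) [Ring A] [Algebra R A]
    (p : PrimeSpectrum R) : ℕ :=
  Nat.sqrt (Module.rankAtStalk (R := R) A p)

/-- The greatest common divisor of a set of natural numbers: its largest common divisor if the
set contains a nonzero number, and `0` otherwise (then the common divisors are unbounded). -/
noncomputable def setGcd (S : Set ℕ) : ℕ :=
  sSup {d : ℕ | ∀ n ∈ S, d ∣ n}

/-- The index of an Azumaya `R`-algebra `A`: the pointwise greatest common divisor of the degrees
of all Azumaya algebras in the Brauer class of `A`. Azumaya `R`-algebras are finitely generated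
`R`-modules, so up to isomorphism all of them live in the universe of `R`. -/
noncomputable def index (R : Type u) [CommRing R] (A : Type v) [Ring A] [Algebra R A]
    (p : PrimeSpectrum R) : ℕ :=
  setGcd {n : ℕ | ∃ (B : Type u) (_ : Ring B) (_ : Algebra R B),
    IsAzumaya R B ∧ BrauerEquiv R A B ∧ n = degree R B p}

/-- The reduced rank `rank_R P / deg A` of a (finitely generated projective) right `A`-module `P`,
as a function on `Spec R`; the quotient is the exact one, in `ℚ`. -/
noncomputable def reducedRank (R : Type u) [CommRing R] (A : Type v) [Ring A] [Algebra R A]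
    (P : Type w) [AddCommGroup P] [Module R P] [Module Aᵐᵒᵖ P] [IsScalarTower R Aᵐᵒᵖ P]
    (p : PrimeSpectrum R) : ℚ :=
  (Module.rankAtStalk (R := R) P p : ℚ) / (degree R A p : ℚ)

end AzumayaIndex

/-!
Right `A`-modules are modules over the Azumaya algebra `Aᵐᵒᵖ`, and everything is read off from the
ranks over `R` of those which are finitely generated and projective, at the finitely many maximal
ideals of `R`.

The fibres of an Azumaya algebra are simple algebras (`isSimpleRing_baseChange`), over which a
module of larger dimension maps onto every module of smaller dimension. Lifting such maps from all
the residue fields at once shows that, over a semilocal ring, a projective module `Y` is a direct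
summand of every projective module `X` with `rank Y ≤ rank X`
(`exists_complement_of_rankAtStalk_le`). Hence ranks can be subtracted, and Euclid's algorithm
applies to them: among the idempotents `e` for which `eA` has positive rank everywhere, one which
minimizes the sum of the ranks of `eA` at the maximal ideals has the property that `rank eA`
divides the rank of every finitely generated projective right `A`-module
(`exists_isIdempotentElem_rankAtStalk_dvd`). If `Spec R` is disconnected, the division is carried
out on a clopen subset, and idempotents of `R` glue the remainder to the old module elsewhere.

Such an `e` is full, because a power of `eA` maps onto `A`. Restricting `A ⊗ Aᵐᵒᵖ ≃ End_R(A)` to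
summands shows that `eAe` is Azumaya and that `eAe ⊗ Aᵐᵒᵖ ≃ End_R(eA)`
(`cornerMulLeftRight_bijective`). The latter isomorphism yields both the Brauer equivalence of
`eAe` with `A` and the formula `rank eA = deg A * deg eAe`; here the ranks of Azumaya algebras are
perfect squares because their fibres over algebraically closed fields are matrix algebras.

Finally, if `B` is Brauer equivalent to `A`, there is a projective right `A`-module of rank
`deg A * deg B` (`BrauerEquiv.exists_module`). So `deg A * deg eAe` divides `deg A * deg B`, and
`deg eAe` is the greatest common divisor of the degrees in the Brauer class.
-/

namespace AzumayaIndex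

/-! ### Fibres of finitely generated projective modules -/

section Fibres

variable {R : Type*} [CommRing R]

theorem finrank_baseChange_eq_rankAtStalk (M : Type*) [AddCommGroup M] [Module R M]
    [Module.Finite R M] [Module.Projective R M] (K : Type*) [Field K] [Algebra R K] :
    Module.finrank K (K ⊗[R] M) =
      Module.rankAtStalk (R := R) M (PrimeSpectrum.comap (algebraMap R K) ⊥) := by
  rw [← Module.rankAtStalk_baseChange, Module.rankAtStalk_eq_finrank_of_free]
  rfl

theorem rankAtStalk_pos_of_faithfulSMul (M : Type*) [AddCommGroup M] [Module R M]
    [Module.Finite R M] [Module.Projective R M] [FaithfulSMul R M] (p : PrimeSpectrum R) :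
    0 < Module.rankAtStalk (R := R) M p := by
  rw [Module.rankAtStalk_pos_iff_mem_support, Module.support_eq_zeroLocus,
    Module.annihilator_eq_bot.mpr inferInstance]
  simp

theorem rankAtStalk_dual (M : Type*) [AddCommGroup M] [Module R M]
    [Module.Finite R M] [Module.Projective R M] :
    Module.rankAtStalk (R := R) (Module.Dual R M) = Module.rankAtStalk (R := R) M := by
  ext p
  have := Module.finitePresentation_of_projective R M
  have h := Module.FinitePresentation.isBaseChange_map R M R (Localization.AtPrime p.asIdeal)
  rw [Module.rankAtStalk_eq_finrank_tensorProduct, Module.rankAtStalk_eq_finrank_tensorProduct,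
    h.equiv.finrank_eq]
  have e : Localization.AtPrime p.asIdeal ⊗[R] R ≃ₗ[Localization.AtPrime p.asIdeal]
      Localization.AtPrime p.asIdeal :=
    TensorProduct.AlgebraTensorModule.rid R _ _
  have : Module.Free (Localization.AtPrime p.asIdeal) (Localization.AtPrime p.asIdeal ⊗[R] M) :=
    Module.free_of_flat_of_isLocalRing
  rw [(e.congrRight).finrank_eq, Module.finrank_linearMap, Module.finrank_self, mul_one]

theorem rankAtStalk_linearMap (M N : Type*) [AddCommGroup M] [Module R M]
    [Module.Finite R M] [Module.Projective R M] [AddCommGroup N] [Module R N]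
    [Module.Finite R N] [Module.Projective R N] :
    Module.rankAtStalk (R := R) (M →ₗ[R] N) =
      Module.rankAtStalk (R := R) M * Module.rankAtStalk (R := R) N := by
  have h := Module.rankAtStalk_eq_of_equiv (M := Module.Dual R M ⊗[R] N) (dualTensorHomEquiv R M N)
  rw [← h, Module.rankAtStalk_tensorProduct, rankAtStalk_dual]

/-- Projectivity passes down along a projective ring extension. -/
theorem projective_of_projective_algebra (A : Type*) [Ring A] [Algebra R A] [Module.Projective R A]
    (V : Type*) [AddCommGroup V] [Module R V] [Module A V] [IsScalarTower R A V]
    [hV : Module.Projective A V] : Module.Projective R V := by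
  obtain ⟨s, hs⟩ := hV
  classical
  have : Module.Projective R (V →₀ A) := .of_equiv (TensorProduct.finsuppScalarRight R R A V)
  refine Module.Projective.of_split (s.restrictScalars R)
    ((Finsupp.linearCombination A id).restrictScalars R) ?_
  ext x
  exact hs x

end Fibres

/-! ### Fibres of Azumaya algebras -/

section BaseChange

variable {R : Type*} [CommRing R] {A : Type*} [Ring A] [Algebra R A]

/-- The fibres of an Azumaya algebra are simple: as every endomorphism of the `R`-module `A` is
a sum of maps `x ↦ a * x * b`, two-sided ideals are stable under the `K`-linear extension of all
of them, in particular under those which project a given nonzero element to the line through `1`. -/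
theorem isSimpleRing_baseChange [IsAzumaya R A] (K : Type*) [Field K] [Algebra R K] :
    IsSimpleRing (K ⊗[R] A) := by
  rw [isSimpleRing_iff_isTwoSided_imp]
  refine ⟨?_, fun I hI => ?_⟩
  · apply Module.nontrivial_of_finrank_pos (R := K)
    rw [finrank_baseChange_eq_rankAtStalk]
    exact rankAtStalk_pos_of_faithfulSMul A _
  by_contra! h
  obtain ⟨y, hy, hy0⟩ := Submodule.exists_mem_ne_zero_of_ne_bot h.1
  apply h.2
  obtain ⟨n, f, g, -, -, hfg⟩ := Module.Finite.exists_comp_eq_id_of_projective R A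
  -- `I` is stable under the extensions of all endomorphisms of `A`
  have key : ∀ φ : Module.End R A, ∀ z ∈ I, φ.baseChange K z ∈ I := by
    intro φ z hz
    obtain ⟨t, rfl⟩ := (IsAzumaya.AlgHom.mulLeftRight_bij R A).2 φ
    induction t with
    | zero => simp
    | add s t hs ht => simpa [LinearMap.baseChange_add] using add_mem hs ht
    | tmul a b =>
      have : (AlgHom.mulLeftRight R A (a ⊗ₜ b)).baseChange K z =
          (1 ⊗ₜ a) * z * (1 ⊗ₜ b.unop) := by
        clear hz
        induction z with
        | zero => simp
        | add x y hx hy => rw [map_add, hx, hy, mul_add, add_mul]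
        | tmul k x => simp
      rw [this]
      exact I.mul_mem_right _ (I.mul_mem_left _ hz)
  -- a coordinate of `y` with respect to the dual basis is nonzero
  obtain ⟨i, hi⟩ : ∃ i, (LinearMap.proj i ∘ₗ g).baseChange K y ≠ 0 := by
    by_contra! h0
    apply hy0
    have hid : (LinearMap.id : A →ₗ[R] A) =
        ∑ i, LinearMap.toSpanSingleton R A (f (Pi.single i 1)) ∘ₗ (LinearMap.proj i ∘ₗ g) := by
      ext x
      have hx : f (g x) = ∑ i, g x i • f (fun j => if i = j then 1 else 0) :=
        LinearMap.pi_apply_eq_sum_univ f (g x)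
      have hs (i : Fin n) : (Pi.single i 1 : Fin n → R) = fun j => if i = j then 1 else 0 := by
        ext j; simp [Pi.single_apply, eq_comm]
      rw [← hfg, LinearMap.comp_apply, hx]
      simp [hs]
    have h1 : (LinearMap.id : A →ₗ[R] A).baseChange K y = y := by simp
    rw [← h1, hid, ← LinearMap.baseChangeHom_apply, map_sum, LinearMap.sum_apply]
    refine Finset.sum_eq_zero fun i _ => ?_
    rw [LinearMap.baseChangeHom_apply, LinearMap.baseChange_comp, LinearMap.comp_apply, h0,
      map_zero]
  set c := TensorProduct.AlgebraTensorModule.rid R K K ((LinearMap.proj i ∘ₗ g).baseChange K y)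
    with hc
  have hc0 : c ≠ 0 := by simpa [hc] using hi
  have h2 := key (LinearMap.toSpanSingleton R A 1 ∘ₗ (LinearMap.proj i ∘ₗ g)) y hy
  have h3 : (LinearMap.proj i ∘ₗ g).baseChange K y = c ⊗ₜ 1 := by
    rw [hc]; exact ((TensorProduct.AlgebraTensorModule.rid R K K).symm_apply_apply _).symm
  rw [LinearMap.baseChange_comp, LinearMap.comp_apply, h3, LinearMap.baseChange_tmul,
    LinearMap.toSpanSingleton_apply, one_smul] at h2
  rw [Ideal.eq_top_iff_one]
  have h4 := I.mul_mem_left (c⁻¹ ⊗ₜ 1) h2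
  rwa [Algebra.TensorProduct.tmul_mul_tmul, inv_mul_cancel₀ hc0, one_mul] at h4

/-- The rank of an Azumaya algebra is a perfect square, because its fibre over an algebraically
closed field is a matrix algebra. -/
theorem exists_rankAtStalk_eq_sq (A : Type*) [Ring A] [Algebra R A] [IsAzumaya R A]
    (p : PrimeSpectrum R) : ∃ n, 0 < n ∧ Module.rankAtStalk (R := R) A p = n ^ 2 := by
  let K := AlgebraicClosure p.asIdeal.ResidueField
  have := isSimpleRing_baseChange (R := R) (A := A) K
  obtain ⟨n, hn, ⟨e⟩⟩ := IsSimpleRing.exists_algEquiv_matrix_of_isAlgClosed K (K ⊗[R] A)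
  refine ⟨n, Nat.pos_of_neZero n, ?_⟩
  have hp : PrimeSpectrum.comap (algebraMap R K) ⊥ = p := by
    ext x
    change algebraMap R K x = 0 ↔ _
    rw [IsScalarTower.algebraMap_apply R p.asIdeal.ResidueField K, map_eq_zero,
      Ideal.algebraMap_residueField_eq_zero]
  rw [← hp, ← finrank_baseChange_eq_rankAtStalk, e.toLinearEquiv.finrank_eq,
    Module.finrank_matrix]
  simp [sq]

theorem rankAtStalk_eq_degree_sq (A : Type*) [Ring A] [Algebra R A] [IsAzumaya R A]
    (p : PrimeSpectrum R) : Module.rankAtStalk (R := R) A p = degree R A p ^ 2 := by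
  obtain ⟨n, -, h⟩ := exists_rankAtStalk_eq_sq A p
  rw [degree, h, Nat.sqrt_eq']

theorem degree_pos (A : Type*) [Ring A] [Algebra R A] [IsAzumaya R A]
    (p : PrimeSpectrum R) : 0 < degree R A p := by
  have h := rankAtStalk_eq_degree_sq A p
  have := rankAtStalk_pos_of_faithfulSMul A p
  exact Nat.pos_of_ne_zero fun h0 => by simp_all

end BaseChange

/-! ### Surjections between projective modules over an Azumaya algebra -/

section Surjection

/-- Over a simple finite-dimensional algebra, modules are determined by their dimensions, and the
larger one of two modules maps onto the smaller one. -/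
theorem exists_surjective_of_finrank_le (K : Type*) [Field K] (B : Type*) [Ring B] [Algebra K B]
    [Module.Finite K B] [IsSimpleRing B] (X Y : Type*) [AddCommGroup X] [Module K X] [Module B X]
    [IsScalarTower K B X] [Module.Finite K X] [AddCommGroup Y] [Module K Y] [Module B Y]
    [IsScalarTower K B Y] [Module.Finite K Y] (h : Module.finrank K Y ≤ Module.finrank K X) :
    ∃ f : X →ₗ[B] Y, Function.Surjective f := by
  cases subsingleton_or_nontrivial Y with
  | inl _ => exact ⟨0, fun y => ⟨0, Subsingleton.elim _ _⟩⟩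
  | inr _ =>
  have : IsArtinianRing B := IsArtinianRing.of_finite K B
  obtain ⟨_, hB, _⟩ := isSimpleRing_isArtinianRing_iff.mp ⟨‹IsSimpleRing B›, this⟩
  have : Module.Finite B X := Module.Finite.of_restrictScalars_finite K B X
  have : Module.Finite B Y := Module.Finite.of_restrictScalars_finite K B Y
  obtain ⟨S, hS⟩ := IsSemisimpleModule.exists_simple_submodule B Y
  have inr_inj : Function.Injective (LinearMap.inr B X Y) := LinearMap.inr_injective
  let e := Submodule.equivMapOfInjective (LinearMap.inr B X Y) inr_inj S
  have : IsSimpleModule B (S.map (LinearMap.inr B X Y)) := .congr e.symm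
  -- `X` and `Y` are powers of the same simple module `S`
  have hS' : IsIsotypicOfType B (X × Y) S :=
    (IsIsotypic.of_self (X × Y) hB (S.map (LinearMap.inr B X Y))).of_linearEquiv_type e.symm
  obtain ⟨a, ⟨eX⟩⟩ := (hS'.of_injective _ LinearMap.inl_injective).linearEquiv_fun (M := X)
  obtain ⟨b, ⟨eY⟩⟩ := (hS'.of_injective _ inr_inj).linearEquiv_fun (M := Y)
  have : Module.Finite K S := .of_injective (S.subtype.restrictScalars K) S.subtype_injective
  have := IsSimpleModule.nontrivial B S
  have hab : b ≤ a := by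
    rw [(eX.restrictScalars K).finrank_eq, (eY.restrictScalars K).finrank_eq,
      Module.finrank_pi_fintype, Module.finrank_pi_fintype] at h
    simp only [Finset.sum_const, Finset.card_univ, Fintype.card_fin, smul_eq_mul] at h
    exact Nat.le_of_mul_le_mul_right h Module.finrank_pos
  refine ⟨eY.symm.toLinearMap ∘ₗ LinearMap.funLeft B S (Fin.castLE hab) ∘ₗ eX.toLinearMap, ?_⟩
  simpa using LinearMap.funLeft_surjective_of_injective B S _ (Fin.castLE_injective hab)

variable {R : Type*} [CommRing R] (B : Type*) [Ring B] [Algebra R B]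

section BaseChangeModule

variable (K : Type*) [CommRing K] [Algebra R K] (X : Type*) [AddCommGroup X] [Module R X]
  [Module B X] [IsScalarTower R B X]

/-- The action of `K ⊗ B` on `K ⊗ X`, for an `R`-algebra `K` and a `B`-module `X`. -/
noncomputable def baseChangeAction : K ⊗[R] B →ₐ[K] Module.End K (K ⊗[R] X) :=
  Algebra.TensorProduct.lift (Algebra.ofId K (Module.End K (K ⊗[R] X)))
    ((Module.End.baseChangeHom R K X).comp (Algebra.lsmul R R X))
    (fun k _ => by rw [Algebra.ofId_apply]; exact Algebra.commute_algebraMap_left k _)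

@[simp]
theorem baseChangeAction_tmul (k l : K) (b : B) (x : X) :
    baseChangeAction B K X (k ⊗ₜ[R] b) (l ⊗ₜ[R] x) = (k * l) ⊗ₜ (b • x) := by
  have h : baseChangeAction B K X (k ⊗ₜ[R] b) (l ⊗ₜ[R] x) = k • (l ⊗ₜ[R] (b • x)) := by
    rw [baseChangeAction, Algebra.TensorProduct.lift_tmul]
    rfl
  rw [h, TensorProduct.smul_tmul', smul_eq_mul]

/-- `K ⊗ X` as a module over `K ⊗ B`, for an `R`-algebra `K` and a `B`-module `X`. -/
noncomputable abbrev baseChangeModule : Module (K ⊗[R] B) (K ⊗[R] X) :=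
  Module.compHom _ (baseChangeAction (R := R) B K X).toRingHom

theorem isScalarTower_baseChangeModule :
    letI := baseChangeModule (R := R) B K X
    IsScalarTower K (K ⊗[R] B) (K ⊗[R] X) :=
  letI := baseChangeModule (R := R) B K X
  ⟨fun k t x => LinearMap.congr_fun (map_smul (baseChangeAction (R := R) B K X) k t) x⟩

theorem one_tmul_smul_one_tmul (b : B) (x : X) :
    letI := baseChangeModule (R := R) B K X
    (1 ⊗ₜ[R] b : K ⊗[R] B) • (1 ⊗ₜ[R] x : K ⊗[R] X) = 1 ⊗ₜ (b • x) :=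
  (baseChangeAction_tmul B K X 1 1 b x).trans (by rw [one_mul])

end BaseChangeModule

/-- At a maximal ideal `m` with residue field `K`, a surjection `K ⊗ X → K ⊗ Y` over the simple
algebra `K ⊗ B` lifts to a `B`-linear map `X → Y`, because `X` is projective over `B`. -/
theorem exists_surjective_mod_of_rankAtStalk_le [IsAzumaya R B]
    (X Y : Type*) [AddCommGroup X] [Module R X] [Module B X] [IsScalarTower R B X]
    [Module.Finite R X] [Module.Projective B X] [AddCommGroup Y] [Module R Y] [Module B Y]
    [IsScalarTower R B Y] [Module.Finite R Y] [Module.Projective B Y]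
    (m : MaximalSpectrum R)
    (h : Module.rankAtStalk (R := R) Y m.toPrimeSpectrum ≤
      Module.rankAtStalk (R := R) X m.toPrimeSpectrum) :
    ∃ f : X →ₗ[B] Y, ∀ y, ∃ x, y - f x ∈ m.asIdeal • (⊤ : Submodule R Y) := by
  have := projective_of_projective_algebra (R := R) B X
  have := projective_of_projective_algebra (R := R) B Y
  have := m.isMaximal
  let K := R ⧸ m.asIdeal
  let : Field K := Ideal.Quotient.field m.asIdeal
  have hm : PrimeSpectrum.comap (algebraMap R K) ⊥ = m.toPrimeSpectrum := by
    ext x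
    exact Ideal.Quotient.eq_zero_iff_mem
  rw [← hm, ← finrank_baseChange_eq_rankAtStalk, ← finrank_baseChange_eq_rankAtStalk] at h
  let := baseChangeModule (R := R) B K X
  let := baseChangeModule (R := R) B K Y
  have := isScalarTower_baseChangeModule (R := R) B K X
  have := isScalarTower_baseChangeModule (R := R) B K Y
  have := isSimpleRing_baseChange (R := R) (A := B) K
  obtain ⟨φ, hφ⟩ := exists_surjective_of_finrank_le K (K ⊗[R] B) (K ⊗[R] X) (K ⊗[R] Y) h
  let : Module B (K ⊗[R] Y) :=
    Module.compHom _ (Algebra.TensorProduct.includeRight : B →ₐ[R] K ⊗[R] B).toRingHom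
  let q : Y →ₗ[B] K ⊗[R] Y :=
    { toFun := fun y => 1 ⊗ₜ y
      map_add' := fun y y' => TensorProduct.tmul_add _ _ _
      map_smul' := fun b y => (one_tmul_smul_one_tmul B K Y b y).symm }
  let g : X →ₗ[B] K ⊗[R] Y :=
    { toFun := fun x => φ (1 ⊗ₜ x)
      map_add' := fun y y' => by rw [TensorProduct.tmul_add, map_add]
      map_smul' := fun b x => by
        rw [← one_tmul_smul_one_tmul B K X b x, map_smul]
        rfl }
  obtain ⟨f, hf⟩ := Module.projective_lifting_property q g
    (TensorProduct.mk_surjective R Y K Ideal.Quotient.mk_surjective)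
  refine ⟨f, fun y => ?_⟩
  obtain ⟨t, ht⟩ := hφ (1 ⊗ₜ y)
  obtain ⟨x, rfl⟩ := TensorProduct.mk_surjective R X K Ideal.Quotient.mk_surjective t
  refine ⟨x, ?_⟩
  have h0 : (1 : K) ⊗ₜ[R] (y - f x) = 0 := by
    rw [TensorProduct.tmul_sub, ← ht, sub_eq_zero]
    exact (LinearMap.congr_fun hf x).symm
  have h1 := TensorProduct.quotTensorEquivQuotSMul_mk_tmul m.asIdeal 1 (y - f x)
  rw [map_one, h0, map_zero, one_smul] at h1
  exact (Submodule.Quotient.mk_eq_zero _).mp h1.symm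

/-- Over a semilocal ring, local surjections can be patched by the Chinese remainder theorem and
Nakayama's lemma. -/
theorem exists_surjective_of_rankAtStalk_le [Finite (MaximalSpectrum R)] [IsAzumaya R B]
    (X Y : Type*) [AddCommGroup X] [Module R X] [Module B X] [IsScalarTower R B X]
    [Module.Finite R X] [Module.Projective B X] [AddCommGroup Y] [Module R Y] [Module B Y]
    [IsScalarTower R B Y] [Module.Finite R Y] [Module.Projective B Y]
    (h : ∀ m : MaximalSpectrum R, Module.rankAtStalk (R := R) Y m.toPrimeSpectrum ≤
      Module.rankAtStalk (R := R) X m.toPrimeSpectrum) :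
    ∃ f : X →ₗ[B] Y, Function.Surjective f := by
  choose f hf using fun m => exists_surjective_mod_of_rankAtStalk_le B X Y m (h m)
  have := Fintype.ofFinite (MaximalSpectrum R)
  classical
  have hcop : Pairwise (Function.onFun IsCoprime fun m : MaximalSpectrum R => m.asIdeal) :=
    fun m m' hmm => Ideal.isCoprime_of_isMaximal fun he => hmm (MaximalSpectrum.ext he)
  -- `r m` is `1` modulo `m` and `0` modulo the other maximal ideals
  choose r hr using fun m => Ideal.exists_forall_sub_mem_ideal hcop (Pi.single m (1 : R))
  let F : X →ₗ[B] Y := ∑ m, r m • f m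
  have hF (m : MaximalSpectrum R) (y : Y) :
      ∃ x, y - F x ∈ m.asIdeal • (⊤ : Submodule R Y) := by
    obtain ⟨x, hx⟩ := hf m y
    refine ⟨x, ?_⟩
    have : y - F x = (y - f m x) -
        ∑ m', (r m' - (Pi.single m' 1 : MaximalSpectrum R → R) m) • f m' x := by
      simp [F, sub_smul, Pi.single_apply]
    rw [this]
    exact sub_mem hx (sum_mem fun m' _ => Submodule.smul_mem_smul (hr m' m) trivial)
  refine ⟨F, ?_⟩
  let N : Submodule R Y := LinearMap.range (F.restrictScalars R)
  suffices hN : N = ⊤ from (LinearMap.range_eq_top (f := F.restrictScalars R)).mp hN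
  by_contra hN
  -- the cokernel of `F` satisfies `C = m C` for all `m`, so by Nakayama's lemma it vanishes
  have hann : Module.annihilator R (Y ⧸ N) ≠ ⊤ := by
    rwa [Ne, Module.annihilator_eq_top_iff, Submodule.Quotient.subsingleton_iff]
  obtain ⟨m, hm, hle⟩ := Ideal.exists_le_maximal _ hann
  obtain ⟨s, hs, hs0⟩ := Submodule.exists_sub_one_mem_and_smul_eq_zero_of_fg_of_le_smul m
    (⊤ : Submodule R (Y ⧸ N)) Module.Finite.fg_top (fun z _ => by
      obtain ⟨y, rfl⟩ := N.mkQ_surjective z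
      obtain ⟨x, hx⟩ := hF ⟨m, hm⟩ y
      have h1 : N.mkQ y = N.mkQ (y - F x) := by
        rw [map_sub, eq_comm, sub_eq_self, Submodule.mkQ_apply, Submodule.Quotient.mk_eq_zero]
        exact ⟨x, rfl⟩
      rw [h1]
      have h2 := Submodule.mem_map_of_mem (f := N.mkQ) hx
      rw [Submodule.map_smul''] at h2
      exact Submodule.smul_mono le_rfl le_top h2)
  have hsm : s ∈ m := hle (Module.mem_annihilator.mpr fun z => hs0 z trivial)
  exact hm.ne_top ((Ideal.eq_top_iff_one m).mpr (by simpa using sub_mem hsm hs))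

end Surjection

/-! ### Corners of Azumaya algebras -/

/-- If `T' → End M` is a retract of a bijective map `T → End N`, along a retract `M` of `N`,
then it is bijective. -/
theorem bijective_of_retract {R : Type*} [CommRing R] {N M T T' : Type*} [AddCommMonoid N]
    [Module R N] [AddCommMonoid M] [Module R M] [AddCommMonoid T] [Module R T] [AddCommMonoid T']
    [Module R T'] (i : M →ₗ[R] N) (r : N →ₗ[R] M) (hri : ∀ x, r (i x) = x)
    (j : T' →ₗ[R] T) (s : T →ₗ[R] T') (hsj : ∀ t, s (j t) = t)
    (Φ : T →ₗ[R] Module.End R N) (hΦ : Function.Bijective Φ) (Φ' : T' →ₗ[R] Module.End R M)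
    (h₁ : ∀ t x, Φ (j t) x = i (Φ' t (r x))) (h₂ : ∀ t x, Φ' (s t) x = r (Φ t (i x))) :
    Function.Bijective Φ' := by
  refine ⟨fun t t' ht => ?_, fun f => ?_⟩
  · have : Φ (j t) = Φ (j t') := by ext x; simp [h₁, ht]
    rw [← hsj t, hΦ.1 this, hsj]
  · obtain ⟨t, ht⟩ := hΦ.2 (i ∘ₗ f ∘ₗ r)
    refine ⟨s t, ?_⟩
    ext x
    rw [h₂, ht]
    simp [hri]

/-- A linear map, regarded as a map of the opposite modules. -/
def opLinearMap {R M N : Type*} [CommRing R] [AddCommGroup M] [Module R M] [AddCommGroup N]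
    [Module R N] (f : M →ₗ[R] N) : Mᵐᵒᵖ →ₗ[R] Nᵐᵒᵖ :=
  (MulOpposite.opLinearEquiv R).toLinearMap ∘ₗ f ∘ₗ (MulOpposite.opLinearEquiv R).symm.toLinearMap

@[simp]
theorem opLinearMap_apply {R M N : Type*} [CommRing R] [AddCommGroup M] [Module R M]
    [AddCommGroup N] [Module R N] (f : M →ₗ[R] N) (x : Mᵐᵒᵖ) :
    opLinearMap f x = MulOpposite.op (f x.unop) := rfl

variable {R : Type*} [CommRing R] {A : Type*} [Ring A] [Algebra R A]

theorem isAzumaya_mulOpposite [IsAzumaya R A] : IsAzumaya R Aᵐᵒᵖ :=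
  have : Module.Projective R Aᵐᵒᵖ := .of_equiv (MulOpposite.opLinearEquiv R : A ≃ₗ[R] Aᵐᵒᵖ)
  have : FaithfulSMul R Aᵐᵒᵖ :=
    ⟨fun {r s} h => FaithfulSMul.eq_of_smul_eq_smul fun a : A =>
      MulOpposite.op_injective (h (.op a))⟩
  { bij := by
      let o := MulOpposite.opLinearEquiv R (M := A)
      let o' := MulOpposite.opLinearEquiv R (M := Aᵐᵒᵖ)
      refine bijective_of_retract (T := A ⊗[R] Aᵐᵒᵖ) o.symm.toLinearMap o.toLinearMap (fun x => rfl)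
        ((TensorProduct.comm R Aᵐᵒᵖ A).toLinearMap ∘ₗ
          TensorProduct.map .id (o.symm.toLinearMap ∘ₗ o'.symm.toLinearMap))
        (TensorProduct.map .id (o'.toLinearMap ∘ₗ o.toLinearMap) ∘ₗ
          (TensorProduct.comm R A Aᵐᵒᵖ).toLinearMap) (fun t => ?_)
        (AlgHom.mulLeftRight R A).toLinearMap IsAzumaya.bij
        (AlgHom.mulLeftRight R Aᵐᵒᵖ).toLinearMap (fun t x => ?_) (fun t x => ?_)
      · induction t with
        | zero => simp
        | add x y hx hy => rw [map_add, map_add, hx, hy]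
        | tmul a b => rfl
      · induction t with
        | zero => simp
        | add x y hx hy => simp only [map_add, LinearMap.add_apply, hx, hy]
        | tmul a b => simp [o, o', mul_assoc]
      · induction t with
        | zero => simp
        | add x y hx hy => simp only [map_add, LinearMap.add_apply, hx, hy]
        | tmul a b => simp [o, o', mul_assoc] }

section Corner

variable {e : A} (he : IsIdempotentElem e)

variable (R) in
/-- The inclusion of `eAe` into `A`. -/
def cornerInclusion : he.Corner →ₗ[R] A where
  toFun := Subtype.val
  map_add' _ _ := rfl
  map_smul' _ _ := rfl

variable (R) in
/-- The projection `x ↦ exe` of `A` onto `eAe`. -/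
def cornerProjection : A →ₗ[R] he.Corner where
  toFun x := ⟨e * x * e, x, rfl⟩
  map_add' x y := Subtype.ext (by
    change e * (x + y) * e = e * x * e + e * y * e
    rw [mul_add, add_mul])
  map_smul' r x := Subtype.ext (by
    change e * (r • x) * e = r • (e * x * e)
    rw [mul_smul_comm, smul_mul_assoc])

theorem mul_corner (c : he.Corner) : e * c.1 = c.1 := ((Subsemigroup.mem_corner_iff he).mp c.2).1

theorem corner_mul (c : he.Corner) : c.1 * e = c.1 := ((Subsemigroup.mem_corner_iff he).mp c.2).2

theorem cornerProjection_inclusion (c : he.Corner) :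
    cornerProjection R he (cornerInclusion R he c) = c :=
  Subtype.ext (by
    change e * c.1 * e = c.1
    rw [mul_corner, corner_mul])

include he in
theorem mem_rightIdeal {x : A} : x ∈ rightIdeal e ↔ e * x = x := by
  rw [rightIdeal, Submodule.mem_span_singleton]
  constructor
  · rintro ⟨a, rfl⟩
    rw [MulOpposite.smul_eq_mul_unop, ← mul_assoc, he.eq]
  · exact fun h => ⟨.op x, h⟩

/-- The projection `x ↦ ex` of `A` onto `eA`. -/
def rightIdealProjection : A →ₗ[Aᵐᵒᵖ] rightIdeal e where
  toFun x := ⟨e * x, (mem_rightIdeal he).mpr (by rw [← mul_assoc, he.eq])⟩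
  map_add' x y := Subtype.ext (mul_add _ _ _)
  map_smul' a x := Subtype.ext (by simp [MulOpposite.smul_eq_mul_unop, mul_assoc])

theorem rightIdealProjection_coe (x : rightIdeal e) : rightIdealProjection he x = x :=
  Subtype.ext ((mem_rightIdeal he).mp x.2)

/-- The action of `eAe` on `eA` by multiplication from the left. -/
def cornerAction : he.Corner →ₐ[R] Module.End R (rightIdeal e) :=
  AlgHom.ofLinearMap
    { toFun := fun c =>
        { toFun := fun x => ⟨c.1 * x.1, (mem_rightIdeal he).mpr (by
            rw [← mul_assoc, mul_corner])⟩
          map_add' := fun x y => Subtype.ext (mul_add _ _ _)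
          map_smul' := fun r x => Subtype.ext (mul_smul_comm _ _ _) }
      map_add' := fun c d => LinearMap.ext fun x => Subtype.ext (add_mul _ _ _)
      map_smul' := fun r c => LinearMap.ext fun x => Subtype.ext (smul_mul_assoc _ _ _) }
    (LinearMap.ext fun x => Subtype.ext ((mem_rightIdeal he).mp x.2))
    (fun c d => LinearMap.ext fun x => Subtype.ext (mul_assoc _ _ _))

/-- The map `eAe ⊗ Aᵐᵒᵖ → End_R(eA)` sending `c ⊗ a` to `x ↦ c * x * a`. -/
def cornerMulLeftRight : he.Corner ⊗[R] Aᵐᵒᵖ →ₐ[R] Module.End R (rightIdeal e) :=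
  Algebra.TensorProduct.lift (cornerAction he) (Algebra.lsmul R R (rightIdeal e))
    (fun _ _ => LinearMap.ext fun _ => Subtype.ext (mul_assoc _ _ _).symm)

theorem cornerMulLeftRight_tmul (c : he.Corner) (a : Aᵐᵒᵖ) (x : rightIdeal e) :
    (cornerMulLeftRight (R := R) he (c ⊗ₜ a) x).1 = c.1 * x.1 * a.unop := by
  have h := Algebra.TensorProduct.lift_tmul (cornerAction (R := R) he)
    (Algebra.lsmul R R (rightIdeal e))
    (fun _ _ => LinearMap.ext fun _ => Subtype.ext (mul_assoc _ _ _).symm) c a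
  rw [mul_assoc]
  exact congrArg Subtype.val (LinearMap.congr_fun h x)

theorem cornerMulLeftRight_bijective [IsAzumaya R A] :
    Function.Bijective (cornerMulLeftRight (R := R) he) := by
  refine bijective_of_retract (T' := he.Corner ⊗[R] Aᵐᵒᵖ) ((rightIdeal e).subtype.restrictScalars R)
    ((rightIdealProjection he).restrictScalars R) (rightIdealProjection_coe he)
    (TensorProduct.map (cornerInclusion R he) .id) (TensorProduct.map (cornerProjection R he) .id)
    (fun t => ?_) (AlgHom.mulLeftRight R A).toLinearMap IsAzumaya.bij
    (cornerMulLeftRight he).toLinearMap (fun t x => ?_) (fun t x => ?_)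
  · induction t with
    | zero => simp
    | add x y hx hy => rw [map_add, map_add, hx, hy]
    | tmul a b => simp [cornerProjection_inclusion]
  · induction t with
    | zero => simp
    | add x y hx hy => simp only [map_add, LinearMap.add_apply, hx, hy]
    | tmul c a =>
      have h : (cornerMulLeftRight (R := R) he (c ⊗ₜ a) (rightIdealProjection he x)).1 =
          c.1 * x * a.unop := by
        rw [cornerMulLeftRight_tmul]
        change c.1 * (e * x) * a.unop = _
        rw [← mul_assoc, corner_mul]
      exact (AlgHom.mulLeftRight_apply R A _ _ _).trans h.symm
  · induction t with
    | zero => simp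
    | add x y hx hy => simp only [map_add, LinearMap.add_apply, hx, hy]
    | tmul c a =>
      apply Subtype.ext
      have h : (rightIdealProjection he (AlgHom.mulLeftRight R A (c ⊗ₜ a) x.1)).1 =
          e * c * e * x.1 * a.unop := by
        rw [AlgHom.mulLeftRight_apply]
        change e * (c * x.1 * a.unop) = _
        conv_lhs => rw [← (mem_rightIdeal he).mp x.2]
        simp only [mul_assoc]
      exact (cornerMulLeftRight_tmul he _ _ _).trans h.symm

/-- The elements of `A` killed by `r` form a two-sided ideal, so `r` is zero if it kills a full
idempotent. -/
theorem smul_eq_zero_of_isFull [FaithfulSMul R A] (hf : IsFull e) {r : R} (hr : r • e = 0) :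
    r = 0 := by
  have h1 : (1 : A) ∈ TwoSidedIdeal.span {e} := by rw [hf]; trivial
  have h2 : r • (1 : A) = 0 := by
    rw [TwoSidedIdeal.mem_span_iff] at h1
    have := h1 (TwoSidedIdeal.mk' {x : A | r • x = 0} (by simp)
      (fun {x y} hx hy => by simp_all) (fun {x} hx => by simp_all)
      (fun {x y} hy => by simp_all [← mul_smul_comm]) (fun {x y} hy => by
        simp_all [← smul_mul_assoc])) (by simpa using hr)
    simpa using this
  apply FaithfulSMul.eq_of_smul_eq_smul (α := A)
  intro a
  rw [zero_smul, ← one_mul a, ← smul_mul_assoc, h2, zero_mul]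

theorem isAzumaya_corner [IsAzumaya R A] (hf : IsFull e) : IsAzumaya R he.Corner :=
  have : Module.Projective R he.Corner := .of_split (cornerInclusion R he)
    (cornerProjection R he) (LinearMap.ext (cornerProjection_inclusion he))
  have : Module.Finite R he.Corner := .of_surjective (cornerProjection R he)
    fun c => ⟨_, cornerProjection_inclusion he c⟩
  have : FaithfulSMul R he.Corner := ⟨fun {r s} h => by
    rw [← sub_eq_zero]
    refine smul_eq_zero_of_isFull hf ?_
    rw [sub_smul, sub_eq_zero]
    exact congrArg Subtype.val (h 1)⟩
  { bij := by
      refine bijective_of_retract (T' := he.Corner ⊗[R] he.Cornerᵐᵒᵖ)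
        (cornerInclusion R he) (cornerProjection R he)
        (cornerProjection_inclusion he)
        (TensorProduct.map (cornerInclusion R he) (opLinearMap (cornerInclusion R he)))
        (TensorProduct.map (cornerProjection R he) (opLinearMap (cornerProjection R he)))
        (fun t => ?_) (AlgHom.mulLeftRight R A).toLinearMap IsAzumaya.bij
        (AlgHom.mulLeftRight R he.Corner).toLinearMap (fun t x => ?_) (fun t x => ?_)
      · induction t with
        | zero => simp
        | add x y hx hy => rw [map_add, map_add, hx, hy]
        | tmul a b => simp [cornerProjection_inclusion]
      · induction t with
        | zero => simp
        | add x y hx hy => simp only [map_add, LinearMap.add_apply, hx, hy]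
        | tmul c d =>
          have h : c.1 * x * d.unop.1 = c.1 * (e * x * e) * d.unop.1 := by
            conv_lhs => rw [← corner_mul he c, ← mul_corner he d.unop]
            simp only [mul_assoc]
          exact (AlgHom.mulLeftRight_apply R A _ _ _).trans (h.trans
            (congrArg Subtype.val (AlgHom.mulLeftRight_apply R he.Corner c d
              (cornerProjection R he x))).symm)
      · induction t with
        | zero => simp
        | add x y hx hy => simp only [map_add, LinearMap.add_apply, hx, hy]
        | tmul c d =>
          apply Subtype.ext
          have h : (e * c * e) * x.1 * (e * d.unop * e) = e * (c * x.1 * d.unop) * e := by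
            conv_rhs => rw [← corner_mul he x, ← mul_corner he x]
            simp only [mul_assoc]
          exact (congrArg Subtype.val (AlgHom.mulLeftRight_apply R he.Corner _ _ x)).trans
            (h.trans (congrArg (e * · * e) (AlgHom.mulLeftRight_apply R A _ _ _)).symm) }

/-! ### The right ideal generated by an idempotent -/

instance projective_mulOpposite_self (A : Type*) [Ring A] : Module.Projective Aᵐᵒᵖ A :=
  .of_equiv
    { toFun := MulOpposite.unop
      invFun := MulOpposite.op
      map_add' := fun _ _ => rfl
      map_smul' := fun _ _ => rfl
      left_inv := fun _ => rfl
      right_inv := fun _ => rfl : Aᵐᵒᵖ ≃ₗ[Aᵐᵒᵖ] A }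

include he in
theorem projective_rightIdeal : Module.Projective Aᵐᵒᵖ (rightIdeal e) :=
  .of_split (rightIdeal e).subtype (rightIdealProjection he)
    (LinearMap.ext (rightIdealProjection_coe he))

include he in
theorem finite_rightIdeal [Module.Finite R A] : Module.Finite R (rightIdeal e) :=
  .of_surjective ((rightIdealProjection he).restrictScalars R)
    fun x => ⟨x, rightIdealProjection_coe he x⟩

include he in
theorem projective_rightIdeal_base [Module.Projective R A] : Module.Projective R (rightIdeal e) :=
  .of_split ((rightIdeal e).subtype.restrictScalars R)
    ((rightIdealProjection he).restrictScalars R) (LinearMap.ext (rightIdealProjection_coe he))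

theorem faithfulSMul_rightIdeal [FaithfulSMul R A] (hf : IsFull e) :
    FaithfulSMul R (rightIdeal e) := ⟨fun {r s} h => by
  rw [← sub_eq_zero]
  refine smul_eq_zero_of_isFull hf ?_
  rw [sub_smul, sub_eq_zero]
  exact congrArg Subtype.val (h ⟨e, Submodule.mem_span_singleton_self e⟩)⟩

/-- The comparison of ranks in `eAe ⊗ Aᵐᵒᵖ ≃ End_R(eA)`. -/
theorem rankAtStalk_rightIdeal_sq [IsAzumaya R A] (hC : IsAzumaya R he.Corner)
    (p : PrimeSpectrum R) :
    Module.rankAtStalk (R := R) (rightIdeal e) p ^ 2 =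
      Module.rankAtStalk (R := R) he.Corner p * Module.rankAtStalk (R := R) A p := by
  have := finite_rightIdeal (R := R) he
  have := projective_rightIdeal_base (R := R) he
  have : IsAzumaya R Aᵐᵒᵖ := isAzumaya_mulOpposite
  have h := Module.rankAtStalk_eq_of_equiv (M := he.Corner ⊗[R] Aᵐᵒᵖ)
    (N := rightIdeal e →ₗ[R] rightIdeal e)
    (LinearEquiv.ofBijective (cornerMulLeftRight (R := R) he).toLinearMap
      (cornerMulLeftRight_bijective he))
  have h2 := congrFun (rankAtStalk_linearMap (R := R) (rightIdeal e) (rightIdeal e)) p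
  rw [← h, Module.rankAtStalk_tensorProduct,
    ← Module.rankAtStalk_eq_of_equiv (MulOpposite.opLinearEquiv R : A ≃ₗ[R] Aᵐᵒᵖ)] at h2
  rw [sq]
  exact h2.symm

/-- `rank eA = deg A * deg eAe`. -/
theorem rankAtStalk_rightIdeal [IsAzumaya R A] (hC : IsAzumaya R he.Corner)
    (p : PrimeSpectrum R) :
    Module.rankAtStalk (R := R) (rightIdeal e) p = degree R A p * degree R he.Corner p := by
  have h := rankAtStalk_rightIdeal_sq he hC p
  rw [rankAtStalk_eq_degree_sq A, rankAtStalk_eq_degree_sq he.Corner, ← mul_pow] at h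
  rw [Nat.pow_left_injective two_ne_zero h, mul_comm]

end Corner

/-! ### Brauer equivalence -/

/-- In the definition of Brauer equivalence, the projective modules may live in any universe. -/
theorem brauerEquiv_of_algEquiv {R : Type u} [CommRing R] {A : Type*} [Ring A] [Algebra R A]
    {B : Type*} [Ring B] [Algebra R B] (P Q : Type*) [AddCommGroup P] [Module R P] [AddCommGroup Q]
    [Module R Q] [Module.Finite R P] [Module.Projective R P] [FaithfulSMul R P]
    [Module.Finite R Q] [Module.Projective R Q] [FaithfulSMul R Q]
    (e : (A ⊗[R] Module.End R P) ≃ₐ[R] (B ⊗[R] Module.End R Q)) : BrauerEquiv R A B := by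
  have : Small.{u} P := Module.Finite.small.{u} R P
  have : Small.{u} Q := Module.Finite.small.{u} R Q
  let eP := Shrink.linearEquiv.{u} R P
  let eQ := Shrink.linearEquiv.{u} R Q
  refine ⟨Shrink.{u} P, Shrink.{u} Q, inferInstance, inferInstance, inferInstance, inferInstance,
    inferInstance, .of_equiv eP.symm, ⟨fun {r s} h => ?_⟩, inferInstance, .of_equiv eQ.symm,
    ⟨fun {r s} h => ?_⟩, ⟨(Algebra.TensorProduct.congr .refl (eP.conjAlgEquiv R)).trans
      (e.trans (Algebra.TensorProduct.congr .refl (eQ.symm.conjAlgEquiv R)))⟩⟩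
  · exact FaithfulSMul.eq_of_smul_eq_smul fun x : P => by
      simpa using congrArg eP (h (eP.symm x))
  · exact FaithfulSMul.eq_of_smul_eq_smul fun x : Q => by
      simpa using congrArg eQ (h (eQ.symm x))

theorem BrauerEquiv.trans_algEquiv {R : Type u} [CommRing R] {A : Type*} [Ring A] [Algebra R A]
    {B : Type*} [Ring B] [Algebra R B] {C : Type*} [Ring C] [Algebra R C]
    (h : BrauerEquiv R A B) (f : B ≃ₐ[R] C) : BrauerEquiv R A C := by
  obtain ⟨P, Q, _, _, _, _, h1, h2, h3, h4, h5, h6, ⟨e⟩⟩ := h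
  exact ⟨P, Q, _, _, _, _, h1, h2, h3, h4, h5, h6,
    ⟨e.trans (Algebra.TensorProduct.congr f .refl)⟩⟩

/-- A full corner `eAe` is Brauer equivalent to `A`, by the chain of isomorphisms
`A ⊗ End(eA) ≃ A ⊗ (eAe ⊗ Aᵐᵒᵖ) ≃ eAe ⊗ (A ⊗ Aᵐᵒᵖ) ≃ eAe ⊗ End(A)`. -/
theorem brauerEquiv_corner [IsAzumaya R A] {e : A} (he : IsIdempotentElem e) (hf : IsFull e) :
    BrauerEquiv R A he.Corner := by
  have := finite_rightIdeal (R := R) he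
  have := projective_rightIdeal_base (R := R) he
  have := faithfulSMul_rightIdeal (R := R) hf
  let e₁ : he.Corner ⊗[R] Aᵐᵒᵖ ≃ₐ[R] Module.End R (rightIdeal e) :=
    .ofBijective (cornerMulLeftRight he) (cornerMulLeftRight_bijective he)
  let e₂ : A ⊗[R] Aᵐᵒᵖ ≃ₐ[R] Module.End R A :=
    .ofBijective (AlgHom.mulLeftRight R A) IsAzumaya.bij
  exact brauerEquiv_of_algEquiv (rightIdeal e) A
    ((Algebra.TensorProduct.congr .refl e₁.symm).trans
      ((Algebra.TensorProduct.leftComm R A he.Corner Aᵐᵒᵖ).trans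
        (Algebra.TensorProduct.congr .refl e₂)))

/-! ### Direct summands and their ranks -/

section Summands

variable {R : Type*} [CommRing R]

/-- The kernel of a surjection between projective modules is a projective direct summand. -/
theorem exists_kernel_of_surjective (B : Type*) [Ring B] [Algebra R B] [Module.Projective R B]
    {X Y : Type*}
    [AddCommGroup X] [Module R X] [Module B X] [IsScalarTower R B X] [Module.Finite R X]
    [Module.Projective B X] [AddCommGroup Y] [Module R Y] [Module B Y] [IsScalarTower R B Y]
    [Module.Finite R Y] [Module.Projective B Y] (f : X →ₗ[B] Y) (hf : Function.Surjective f) :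
    Module.Projective B (LinearMap.ker f) ∧ Module.Finite R (LinearMap.ker f) ∧
      Module.rankAtStalk (R := R) X =
        Module.rankAtStalk (R := R) (LinearMap.ker f) + Module.rankAtStalk (R := R) Y := by
  obtain ⟨s, hs⟩ := Module.projective_lifting_property f .id hf
  replace hs (y : Y) : f (s y) = y := LinearMap.congr_fun hs y
  let ρ : X →ₗ[B] LinearMap.ker f := LinearMap.codRestrict _ (.id - s ∘ₗ f) (by simp [hs])
  have hρ (z : LinearMap.ker f) : ρ z = z := Subtype.ext (by simp [ρ])
  have h₁ : Module.Projective B (LinearMap.ker f) :=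
    .of_split (LinearMap.ker f).subtype ρ (LinearMap.ext hρ)
  have h₂ : Module.Finite R (LinearMap.ker f) :=
    .of_surjective (ρ.restrictScalars R) fun z => ⟨z, hρ z⟩
  have := projective_of_projective_algebra (R := R) B (LinearMap.ker f)
  have := projective_of_projective_algebra (R := R) B Y
  refine ⟨h₁, h₂, ?_⟩
  let e : X ≃ₗ[B] LinearMap.ker f × Y :=
    { ρ.prod f with
      invFun := fun z => z.1 + s z.2
      left_inv := fun x => by simp [ρ]
      right_inv := fun z => by
        have hz : f z.1 = 0 := z.1.2
        ext <;> simp [ρ, hs, hz] }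
  rw [← Module.rankAtStalk_prod, Module.rankAtStalk_eq_of_equiv (e.restrictScalars R)]

theorem rankAtStalk_eq_zero_of_annihilator {M : Type*} [AddCommGroup M] [Module R M]
    [Module.Finite R M] [Module.Projective R M] {p : PrimeSpectrum R} {r : R}
    (hr : ∀ x : M, r • x = 0) (hp : r ∉ p.asIdeal) : Module.rankAtStalk (R := R) M p = 0 := by
  rw [Module.rankAtStalk_eq_zero_iff_notMem_support, Module.mem_support_iff_of_finite]
  exact fun h => hp (h (Module.mem_annihilator.mpr hr))

/-- The indicator function of a clopen subset of `Spec R` is the rank function of a finitely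
generated projective module, the ideal generated by the corresponding idempotent. -/
theorem exists_rankAtStalk_eq_indicator {U : Set (PrimeSpectrum R)} (hU : IsClopen U) :
    ∃ I : Ideal R, Module.Finite R I ∧ Module.Projective R I ∧
      Module.rankAtStalk (R := R) I = U.indicator 1 := by
  obtain ⟨ε, hε, rfl⟩ := PrimeSpectrum.isClopen_iff.mp hU
  let f : R →ₗ[R] Ideal.span {ε} := LinearMap.codRestrict _ (LinearMap.mulLeft R ε)
    fun x => Ideal.mul_mem_right _ _ (Ideal.mem_span_singleton_self ε)
  have hI (x : Ideal.span {ε}) : ε * x.1 = x.1 := by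
    obtain ⟨a, ha⟩ := Ideal.mem_span_singleton.mp x.2
    rw [ha, ← mul_assoc, hε.eq]
  have hf (x : Ideal.span {ε}) : f x.1 = x := Subtype.ext (hI x)
  have hfs : Function.Surjective f := fun x => ⟨x, hf x⟩
  have h₁ : Module.Finite R (Ideal.span {ε}) := .of_surjective f hfs
  have h₂ : Module.Projective R (Ideal.span {ε}) :=
    .of_split (Ideal.span {ε}).subtype f (LinearMap.ext hf)
  refine ⟨Ideal.span {ε}, h₁, h₂, ?_⟩
  obtain ⟨h₃, h₄, h₅⟩ := exists_kernel_of_surjective (R := R) R f hfs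
  ext p
  have : Nontrivial R := p.nontrivial
  have h₆ := congrFun h₅ p
  rw [Module.rankAtStalk_self] at h₆
  by_cases hp : ε ∈ p.asIdeal
  · rw [Set.indicator_of_notMem (by simpa using hp)]
    refine rankAtStalk_eq_zero_of_annihilator (r := 1 - ε) (fun x => Subtype.ext ?_) fun h => ?_
    · simp [sub_mul, hI]
    · exact p.isPrime.ne_top ((Ideal.eq_top_iff_one _).mpr (by simpa using add_mem h hp))
  · rw [Set.indicator_of_mem (by simpa using hp)]
    have h₇ : Module.rankAtStalk (R := R) (LinearMap.ker f) p = 0 :=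
      rankAtStalk_eq_zero_of_annihilator
        (fun x => Subtype.ext (congrArg Subtype.val (LinearMap.mem_ker.mp x.2) :)) hp
    rw [Pi.add_apply, h₇, zero_add] at h₆
    exact h₆.symm

end Summands

/-- Over an Azumaya algebra over a semilocal ring, a projective module `Y` is a direct summand of
every projective module `X` of larger rank. -/
theorem exists_complement_of_rankAtStalk_le {R : Type*} [CommRing R] [Finite (MaximalSpectrum R)]
    (B : Type*) [Ring B] [Algebra R B] [IsAzumaya R B] (X : Type w) (Y : Type*)
    [AddCommGroup X] [Module R X] [Module B X] [IsScalarTower R B X] [Module.Finite R X]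
    [Module.Projective B X] [AddCommGroup Y] [Module R Y] [Module B Y] [IsScalarTower R B Y]
    [Module.Finite R Y] [Module.Projective B Y]
    (h : ∀ m : MaximalSpectrum R, Module.rankAtStalk (R := R) Y m.toPrimeSpectrum ≤
      Module.rankAtStalk (R := R) X m.toPrimeSpectrum) :
    ∃ (Z : Type w) (_ : AddCommGroup Z) (_ : Module R Z) (_ : Module B Z)
      (_ : IsScalarTower R B Z), Module.Projective B Z ∧ Module.Finite R Z ∧
      Module.rankAtStalk (R := R) X = Module.rankAtStalk (R := R) Z +
        Module.rankAtStalk (R := R) Y := by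
  obtain ⟨f, hf⟩ := exists_surjective_of_rankAtStalk_le B X Y h
  exact ⟨LinearMap.ker f, _, _, _, inferInstance, exists_kernel_of_surjective B f hf⟩

section Semilocal

variable {R : Type*} [CommRing R] {A : Type*} [Ring A] [Algebra R A]
  [Finite (MaximalSpectrum R)] [IsAzumaya R A]

/-- A projective right `A`-module of rank at most `rank A` is a direct summand of `A`. -/
theorem exists_rightIdeal_equiv (V : Type*) [AddCommGroup V] [Module R V] [Module Aᵐᵒᵖ V]
    [IsScalarTower R Aᵐᵒᵖ V] [Module.Finite R V] [Module.Projective Aᵐᵒᵖ V]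
    (h : ∀ m : MaximalSpectrum R, Module.rankAtStalk (R := R) V m.toPrimeSpectrum ≤
      Module.rankAtStalk (R := R) A m.toPrimeSpectrum) :
    ∃ e : A, IsIdempotentElem e ∧ Nonempty (V ≃ₗ[Aᵐᵒᵖ] rightIdeal e) := by
  have : IsAzumaya R Aᵐᵒᵖ := isAzumaya_mulOpposite
  obtain ⟨π, hπ⟩ := exists_surjective_of_rankAtStalk_le Aᵐᵒᵖ A V h
  obtain ⟨s, hs⟩ := Module.projective_lifting_property π .id hπ
  replace hs (y : V) : π (s y) = y := LinearMap.congr_fun hs y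
  have hmul (x : A) : s (π 1) * x = s (π x) := by
    rw [← MulOpposite.unop_op x, ← MulOpposite.smul_eq_mul_unop, ← map_smul, ← map_smul,
      MulOpposite.smul_eq_mul_unop, one_mul]
  have he : IsIdempotentElem (s (π 1)) := by rw [IsIdempotentElem, hmul, hs]
  refine ⟨s (π 1), he, ⟨?_⟩⟩
  exact
    { LinearMap.codRestrict (rightIdeal (s (π 1))) s
        (fun v => (mem_rightIdeal he).mpr (by rw [hmul, hs])) with
      invFun := fun x => π x
      left_inv := hs
      right_inv := fun x => Subtype.ext ((hmul x.1).symm.trans ((mem_rightIdeal he).mp x.2)) }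

/-- If `eA` has positive rank everywhere then some power of it maps onto `A`, so `e` is full. -/
theorem isFull_of_rankAtStalk_pos {e : A} (he : IsIdempotentElem e)
    (h : ∀ m : MaximalSpectrum R,
      0 < Module.rankAtStalk (R := R) (rightIdeal e) m.toPrimeSpectrum) : IsFull e := by
  have : IsAzumaya R Aᵐᵒᵖ := isAzumaya_mulOpposite
  have := finite_rightIdeal (R := R) he
  have := projective_rightIdeal_base (R := R) he
  have := projective_rightIdeal he
  have := Fintype.ofFinite (MaximalSpectrum R)
  let n := ∑ m : MaximalSpectrum R, Module.rankAtStalk (R := R) A m.toPrimeSpectrum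
  have : Module.Finite R (rightIdeal e ⊗[R] (Fin n → R)) := Module.Finite.tensorProduct R _ _
  obtain ⟨f, hf⟩ := exists_surjective_of_rankAtStalk_le Aᵐᵒᵖ (rightIdeal e ⊗[R] (Fin n → R)) A
    fun m => by
      have : Nontrivial R := m.toPrimeSpectrum.nontrivial
      rw [Module.rankAtStalk_tensorProduct, Module.rankAtStalk_eq_finrank_of_free (M := Fin n → R)]
      simp only [Pi.mul_apply, Module.finrank_fin_fun, Pi.natCast_apply, Nat.cast_id]
      calc _ ≤ n := Finset.single_le_sum (f := fun m : MaximalSpectrum R =>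
              Module.rankAtStalk (R := R) A m.toPrimeSpectrum) (fun _ _ => Nat.zero_le _)
              (Finset.mem_univ m)
        _ ≤ _ := Nat.le_mul_of_pos_left _ (h m)
  have key (t : rightIdeal e ⊗[R] (Fin n → R)) : f t ∈ TwoSidedIdeal.span {e} := by
    induction t with
    | zero => rw [map_zero]; exact zero_mem _
    | add x y hx hy => rw [map_add]; exact add_mem hx hy
    | tmul x c =>
      -- `f (x ⊗ c) = f (e ⊗ c) * x = f (e ⊗ c) * e * x`
      have h1 : x ⊗ₜ[R] c = MulOpposite.op x.1 •
          ((⟨e, Submodule.mem_span_singleton_self e⟩ : rightIdeal e) ⊗ₜ[R] c) := by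
        rw [TensorProduct.smul_tmul']
        congr 1
        exact Subtype.ext ((mem_rightIdeal he).mp x.2).symm
      rw [h1, map_smul, MulOpposite.smul_eq_mul_unop, MulOpposite.unop_op,
        ← (mem_rightIdeal he).mp x.2]
      exact TwoSidedIdeal.mul_mem_left _ _ _ (TwoSidedIdeal.mul_mem_right _ _ _
        (TwoSidedIdeal.subset_span rfl))
  obtain ⟨t, ht⟩ := hf 1
  rw [IsFull, ← TwoSidedIdeal.one_mem_iff, ← ht]
  exact key t

/-- There is an idempotent `e` such that `eA` has positive rank everywhere and the rank of every
finitely generated projective right `A`-module is divisible by that of `eA`. It is found by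
minimizing the sum of the ranks of `eA` at the maximal ideals. -/
theorem exists_isIdempotentElem_rankAtStalk_dvd (R : Type*) [CommRing R] (A : Type*) [Ring A]
    [Algebra R A] [Finite (MaximalSpectrum R)] [IsAzumaya R A] :
    ∃ e : A, IsIdempotentElem e ∧
      (∀ m : MaximalSpectrum R,
        0 < Module.rankAtStalk (R := R) (rightIdeal e) m.toPrimeSpectrum) ∧
      ∀ (W : Type w) [AddCommGroup W] [Module R W] [Module Aᵐᵒᵖ W] [IsScalarTower R Aᵐᵒᵖ W]
        [Module.Finite R W] [Module.Projective Aᵐᵒᵖ W] (m : MaximalSpectrum R),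
        Module.rankAtStalk (R := R) (rightIdeal e) m.toPrimeSpectrum ∣
          Module.rankAtStalk (R := R) W m.toPrimeSpectrum := by
  have : IsAzumaya R Aᵐᵒᵖ := isAzumaya_mulOpposite
  have := Fintype.ofFinite (MaximalSpectrum R)
  let size (e : A) : ℕ :=
    ∑ m : MaximalSpectrum R, Module.rankAtStalk (R := R) (rightIdeal e) m.toPrimeSpectrum
  let S : Set A := {e | IsIdempotentElem e ∧ ∀ m : MaximalSpectrum R,
    0 < Module.rankAtStalk (R := R) (rightIdeal e) m.toPrimeSpectrum}
  have h1S : (1 : A) ∈ S := by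
    have := finite_rightIdeal (R := R) (IsIdempotentElem.one (M := A))
    have := projective_rightIdeal_base (R := R) (IsIdempotentElem.one (M := A))
    have hf : IsFull (1 : A) := TwoSidedIdeal.one_mem_iff _ |>.mp (TwoSidedIdeal.subset_span rfl)
    have := faithfulSMul_rightIdeal (R := R) hf
    exact ⟨.one, fun m => rankAtStalk_pos_of_faithfulSMul _ _⟩
  obtain ⟨e, ⟨he, hpos⟩, hmin⟩ := (measure size).wf.has_min S ⟨1, h1S⟩
  refine ⟨e, he, hpos, fun W _ _ _ _ _ _ m => ?_⟩
  have := finite_rightIdeal (R := R) he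
  have := projective_rightIdeal_base (R := R) he
  have := projective_rightIdeal he
  have := projective_of_projective_algebra (R := R) Aᵐᵒᵖ W
  by_contra hdvd
  set V := rightIdeal e
  set d := Module.rankAtStalk (R := R) V m.toPrimeSpectrum with hd
  set k := Module.rankAtStalk (R := R) W m.toPrimeSpectrum with hk
  have hlocV : IsLocallyConstant (Module.rankAtStalk (R := R) V) :=
    have := Module.finitePresentation_of_projective R V
    Module.isLocallyConstant_rankAtStalk
  have hlocW : IsLocallyConstant (Module.rankAtStalk (R := R) W) :=
    have := Module.finitePresentation_of_projective R W
    Module.isLocallyConstant_rankAtStalk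
  -- the remainder of `W` modulo `V` is formed on the clopen set `U`, and glued to `V` off `U`
  let U : Set (PrimeSpectrum R) :=
    Module.rankAtStalk (R := R) V ⁻¹' {d} ∩ Module.rankAtStalk (R := R) W ⁻¹' {k}
  have hU : IsClopen U := (hlocV.isClopen_fiber d).inter (hlocW.isClopen_fiber k)
  obtain ⟨I, _, _, hI⟩ := exists_rankAtStalk_eq_indicator hU
  obtain ⟨J, _, _, hJ⟩ := exists_rankAtStalk_eq_indicator hU.compl
  have : Module.Finite R (W ⊗[R] I) := Module.Finite.tensorProduct R _ _
  have : Module.Finite R (V ⊗[R] J) := Module.Finite.tensorProduct R _ _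
  have : Module.Finite R (V ⊗[R] ((Fin (k / d) → R) ⊗[R] I)) := Module.Finite.tensorProduct R _ _
  have hX : Module.rankAtStalk (R := R) ((W ⊗[R] I) × (V ⊗[R] J)) =
      Module.rankAtStalk W * U.indicator 1 + Module.rankAtStalk V * Uᶜ.indicator 1 := by
    rw [Module.rankAtStalk_prod, Module.rankAtStalk_tensorProduct,
      Module.rankAtStalk_tensorProduct, hI, hJ]
  have hY (p : PrimeSpectrum R) :
      Module.rankAtStalk (R := R) (V ⊗[R] ((Fin (k / d) → R) ⊗[R] I)) p =
      Module.rankAtStalk V p * (k / d * U.indicator 1 p) := by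
    have : Nontrivial R := p.nontrivial
    rw [Module.rankAtStalk_tensorProduct, Module.rankAtStalk_tensorProduct, hI,
      Module.rankAtStalk_eq_finrank_of_free (M := Fin (k / d) → R)]
    simp
  obtain ⟨Z, _, _, _, _, _, _, hZ⟩ := exists_complement_of_rankAtStalk_le (R := R) Aᵐᵒᵖ
    ((W ⊗[R] I) × (V ⊗[R] J))
    (V ⊗[R] ((Fin (k / d) → R) ⊗[R] I)) fun m' => by
      rw [hX, hY]
      by_cases hm : m'.toPrimeSpectrum ∈ U
      · have h1 : Module.rankAtStalk (R := R) V m'.toPrimeSpectrum = d := hm.1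
        have h2 : Module.rankAtStalk (R := R) W m'.toPrimeSpectrum = k := hm.2
        simpa [hm, h1, h2] using Nat.mul_div_le k d
      · simp [hm]
  -- `Z` has rank `k % d` on `U`, and the same rank as `V` elsewhere
  have hZU (p : PrimeSpectrum R) (hp : p ∈ U) :
      Module.rankAtStalk (R := R) Z p = k % d := by
    have h := congrFun hZ p
    have h1 : Module.rankAtStalk (R := R) V p = d := hp.1
    have h2 : Module.rankAtStalk (R := R) W p = k := hp.2
    have h3 := Nat.mod_add_div k d
    rw [Pi.add_apply, hY, hX] at h
    simp [hp, h1, h2] at h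
    omega
  have hZU' (p : PrimeSpectrum R) (hp : p ∉ U) :
      Module.rankAtStalk (R := R) Z p = Module.rankAtStalk (R := R) V p := by
    have h := congrFun hZ p
    rw [Pi.add_apply, hY, hX] at h
    simpa [hp] using h.symm
  have hle (m' : MaximalSpectrum R) :
      Module.rankAtStalk (R := R) Z m'.toPrimeSpectrum ≤
        Module.rankAtStalk (R := R) V m'.toPrimeSpectrum := by
    by_cases hm : m'.toPrimeSpectrum ∈ U
    · have h1 : Module.rankAtStalk (R := R) V m'.toPrimeSpectrum = d := hm.1
      rw [hZU _ hm, h1]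
      exact (Nat.mod_lt _ (hpos m)).le
    · exact (hZU' _ hm).le
  have hVA (p : PrimeSpectrum R) :
      Module.rankAtStalk (R := R) V p ≤ Module.rankAtStalk (R := R) A p := by
    obtain ⟨-, -, h⟩ := exists_kernel_of_surjective (R := R) Aᵐᵒᵖ (rightIdealProjection he)
      fun x => ⟨x, rightIdealProjection_coe he x⟩
    rw [h]
    exact Nat.le_add_left _ _
  obtain ⟨e', he', ⟨E⟩⟩ := exists_rightIdeal_equiv (R := R) (A := A) Z
    fun m' => (hle m').trans (hVA _)
  have hE : Module.rankAtStalk (R := R) Z =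
      Module.rankAtStalk (R := R) (rightIdeal e') :=
    Module.rankAtStalk_eq_of_equiv (E.restrictScalars R)
  rw [hE] at hle
  have hmU : m.toPrimeSpectrum ∈ U := ⟨rfl, rfl⟩
  refine hmin e' ⟨he', fun m' => ?_⟩
    (Finset.sum_lt_sum (fun m' _ => hle m') ⟨m, Finset.mem_univ m, ?_⟩)
  · rw [← hE]
    by_cases hm : m'.toPrimeSpectrum ∈ U
    · rw [hZU _ hm]
      exact Nat.pos_of_ne_zero fun h => hdvd (Nat.dvd_of_mod_eq_zero h)
    · rw [hZU' _ hm]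
      exact hpos m'
  · rw [← hE, hZU _ hmU]
    exact Nat.mod_lt _ (hpos m)

end Semilocal

/-! ### Modules attached to Brauer equivalent algebras -/

/-- Two retracts of a module which define the same idempotent endomorphism are isomorphic. -/
def equivOfRetract {R X₁ X₂ E : Type*} [CommRing R] [AddCommMonoid X₁] [Module R X₁]
    [AddCommMonoid X₂] [Module R X₂] [AddCommMonoid E] [Module R E] (i₁ : X₁ →ₗ[R] E)
    (r₁ : E →ₗ[R] X₁) (i₂ : X₂ →ₗ[R] E) (r₂ : E →ₗ[R] X₂) (h₁ : ∀ x, r₁ (i₁ x) = x)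
    (h₂ : ∀ x, r₂ (i₂ x) = x) (h : ∀ x, i₁ (r₁ x) = i₂ (r₂ x)) : X₁ ≃ₗ[R] X₂ :=
  { r₂ ∘ₗ i₁ with
    invFun := r₁ ∘ₗ i₂
    left_inv := fun x => by simp [← h, h₁]
    right_inv := fun x => by simp [h, h₂] }

section TensorEnd

variable {R : Type*} [CommRing R] {A : Type*} [Ring A] [Algebra R A] (P : Type*) [AddCommGroup P]
  [Module R P]

/-- The action of `A ⊗ End P` on the right `A`-module `A ⊗ P`. -/
noncomputable def tensorEndAction :
    A ⊗[R] Module.End R P →ₐ[R] Module.End Aᵐᵒᵖ (A ⊗[R] P) :=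
  (Module.endTensorEndAlgHom (R := R) (S := R) (A := Aᵐᵒᵖ) (M := A) (N := P)).comp
    (Algebra.TensorProduct.map (Algebra.lsmul R Aᵐᵒᵖ A) (AlgHom.id R (Module.End R P)))

@[simp]
theorem tensorEndAction_tmul (a b : A) (φ : Module.End R P) (x : P) :
    tensorEndAction P (a ⊗ₜ[R] φ) (b ⊗ₜ[R] x) = (a * b) ⊗ₜ φ x :=
  rfl

variable [Module.Finite R P] [Module.Projective R P]

/-- The isomorphism `(A ⊗ P) ⊗ P* ≃ A ⊗ End P`. -/
noncomputable def tensorDualEquiv : (A ⊗[R] P) ⊗[R] Module.Dual R P ≃ₗ[R] A ⊗[R] Module.End R P :=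
  TensorProduct.assoc R A P (Module.Dual R P) ≪≫ₗ
    TensorProduct.congr (.refl R A)
      (TensorProduct.comm R P (Module.Dual R P) ≪≫ₗ dualTensorHomEquiv R P P)

/-- Under `(A ⊗ P) ⊗ P* ≃ A ⊗ End P`, the action on the first factor is multiplication from the
left. -/
theorem tensorDualEquiv_action (g : A ⊗[R] Module.End R P)
    (t : (A ⊗[R] P) ⊗[R] Module.Dual R P) :
    tensorDualEquiv P (LinearMap.rTensor _ ((tensorEndAction P g).restrictScalars R) t) =
      g * tensorDualEquiv P t := by
  induction t with
  | zero => simp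
  | add x y hx hy => rw [map_add, map_add, hx, hy, map_add, mul_add]
  | tmul t ξ =>
  induction t with
  | zero => simp
  | add x y hx hy => rw [TensorProduct.add_tmul, map_add, map_add, hx, hy, map_add, mul_add]
  | tmul b x =>
  induction g with
  | zero => simp
  | add g g' hg hg' =>
    rw [add_mul, ← hg, ← hg', ← map_add, ← LinearMap.add_apply, ← LinearMap.rTensor_add]
    simp
  | tmul a φ =>
    have : dualTensorHom R P P (ξ ⊗ₜ φ x) = φ * dualTensorHom R P P (ξ ⊗ₜ x) := by
      ext y
      simp
    simp [tensorDualEquiv, this]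

end TensorEnd

/-- Given `A ⊗ End P ≃ C ⊗ End Q` and a direct summand `R` of `Q`, with projection `π : Q → R`, let
`f` be the idempotent of `A ⊗ End P` corresponding to `1 ⊗ π`. The right `A`-module `f (A ⊗ P)`
satisfies `f (A ⊗ P) ⊗ P* ≃ f (A ⊗ End P) ≃ C ⊗ Q*`. -/
theorem exists_module_tensor_dual_equiv {R : Type u} [CommRing R] {A : Type v} [Ring A]
    [Algebra R A] [Module.Finite R A] {C : Type*} [Ring C] [Algebra R C] {P : Type w}
    [AddCommGroup P] [Module R P] [Module.Finite R P] [Module.Projective R P] {Q : Type*}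
    [AddCommGroup Q] [Module R Q] [Module.Finite R Q] [Module.Projective R Q]
    (θ : (A ⊗[R] Module.End R P) ≃ₐ[R] (C ⊗[R] Module.End R Q)) (t : Q →ₗ[R] R) (s : R →ₗ[R] Q)
    (hs : t ∘ₗ s = .id) :
    ∃ (W : Type max v w) (_ : AddCommGroup W) (_ : Module R W) (_ : Module Aᵐᵒᵖ W)
      (_ : IsScalarTower R Aᵐᵒᵖ W), Module.Finite R W ∧ Module.Projective Aᵐᵒᵖ W ∧
      Nonempty (W ⊗[R] Module.Dual R P ≃ₗ[R] C ⊗[R] Module.Dual R Q) := by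
  let f : A ⊗[R] Module.End R P := θ.symm (1 ⊗ₜ (s ∘ₗ t))
  have hf : f * f = f := by
    rw [← map_mul, Algebra.TensorProduct.tmul_mul_tmul, mul_one, Module.End.mul_eq_comp,
      LinearMap.comp_assoc, ← LinearMap.comp_assoc t s t, hs, LinearMap.id_comp]
  let F : Module.End Aᵐᵒᵖ (A ⊗[R] P) := tensorEndAction P f
  have hF (x) : F (F x) = F x := by
    rw [← Module.End.mul_apply, ← map_mul, hf]
  let W := LinearMap.range F
  let ρ : A ⊗[R] P →ₗ[Aᵐᵒᵖ] W := F.rangeRestrict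
  have hρ (x : W) : ρ x = x := by
    obtain ⟨_, y, rfl⟩ := x
    exact Subtype.ext (hF y)
  have hAP : Module.Finite R (A ⊗[R] P) := Module.Finite.tensorProduct R _ _
  have hW : Module.Finite R W := .of_surjective (ρ.restrictScalars R) fun x => ⟨x, hρ x⟩
  have hW' : Module.Projective Aᵐᵒᵖ W := .of_split W.subtype ρ (LinearMap.ext hρ)
  refine ⟨W, inferInstance, inferInstance, inferInstance, inferInstance, hW, hW', ⟨?_⟩⟩
  exact equivOfRetract
    ((tensorDualEquiv P).toLinearMap ∘ₗ LinearMap.rTensor _ (W.subtype.restrictScalars R))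
    (LinearMap.rTensor _ (ρ.restrictScalars R) ∘ₗ (tensorDualEquiv P).symm.toLinearMap)
    (θ.symm.toLinearMap ∘ₗ LinearMap.lTensor C (LinearMap.compRight R s))
    (LinearMap.lTensor C (LinearMap.compRight R t) ∘ₗ θ.toLinearMap)
    (fun x => by
      have h : ρ.restrictScalars R ∘ₗ W.subtype.restrictScalars R = .id := LinearMap.ext hρ
      simp [← LinearMap.comp_apply, ← LinearMap.rTensor_comp, h])
    (fun x => by
      have h : LinearMap.compRight R t ∘ₗ LinearMap.compRight R s =
          (.id : Module.Dual R Q →ₗ[R] Module.Dual R Q) := by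
        ext ξ y
        exact LinearMap.congr_fun hs _
      simp [← LinearMap.comp_apply, ← LinearMap.lTensor_comp, h])
    -- both idempotents are multiplication by `f`
    (fun x => by
      trans f * x
      · have h : W.subtype.restrictScalars R ∘ₗ ρ.restrictScalars R = F.restrictScalars R := rfl
        have h' := tensorDualEquiv_action P f ((tensorDualEquiv P).symm x)
        rw [LinearEquiv.apply_symm_apply] at h'
        rw [← h', ← h, LinearMap.rTensor_comp]
        rfl
      · have h (y : C ⊗[R] Module.End R Q) : (1 ⊗ₜ (s ∘ₗ t)) * y =
            LinearMap.lTensor C (LinearMap.compRight R s)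
              (LinearMap.lTensor C (LinearMap.compRight R t) y) := by
          induction y with
          | zero => simp
          | add x y hx hy => rw [mul_add, hx, hy, map_add, map_add]
          | tmul c φ => simp; rfl
        have h' : f * x = θ.symm ((1 ⊗ₜ (s ∘ₗ t)) * θ x) := by rw [map_mul, θ.symm_apply_apply]
        rw [h', h]
        rfl)

/-- If `A` and `C` are Brauer equivalent, there is a projective right `A`-module of rank
`deg A * deg C`. -/
theorem BrauerEquiv.exists_module {R : Type u} [CommRing R] [Finite (MaximalSpectrum R)]
    {A : Type v} [Ring A] [Algebra R A] [IsAzumaya R A] {C : Type*} [Ring C] [Algebra R C]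
    [IsAzumaya R C] (h : BrauerEquiv R A C) :
    ∃ (W : Type max u v) (_ : AddCommGroup W) (_ : Module R W) (_ : Module Aᵐᵒᵖ W)
      (_ : IsScalarTower R Aᵐᵒᵖ W), Module.Finite R W ∧ Module.Projective Aᵐᵒᵖ W ∧
      ∀ p, Module.rankAtStalk (R := R) W p = degree R A p * degree R C p := by
  obtain ⟨P, Q, _, _, _, _, _, _, _, _, _, _, ⟨θ⟩⟩ := h
  obtain ⟨t, ht⟩ := exists_surjective_of_rankAtStalk_le (R := R) R Q R fun m => by
    have : Nontrivial R := m.toPrimeSpectrum.nontrivial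
    rw [Module.rankAtStalk_self]
    exact rankAtStalk_pos_of_faithfulSMul Q _
  obtain ⟨s, hs⟩ := Module.projective_lifting_property t .id ht
  obtain ⟨W, _, _, _, _, hW, hW', ⟨E⟩⟩ := exists_module_tensor_dual_equiv θ t s hs
  have : IsAzumaya R Aᵐᵒᵖ := isAzumaya_mulOpposite
  have := projective_of_projective_algebra (R := R) Aᵐᵒᵖ W
  refine ⟨W, inferInstance, inferInstance, inferInstance, inferInstance, hW, hW', fun p => ?_⟩
  have : Nontrivial R := p.nontrivial
  have h₁ := congrFun (Module.rankAtStalk_eq_of_equiv (M := W ⊗[R] Module.Dual R P)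
    (N := C ⊗[R] Module.Dual R Q) E) p
  rw [Module.rankAtStalk_tensorProduct, Module.rankAtStalk_tensorProduct, rankAtStalk_dual,
    rankAtStalk_dual] at h₁
  have : Module.Finite R (Module.End R P) := 
    have := Module.Finite.tensorProduct R (Module.Dual R P) P
    .equiv (dualTensorHomEquiv R P P)
  have : Module.Finite R (Module.End R Q) := 
    have := Module.Finite.tensorProduct R (Module.Dual R Q) Q
    .equiv (dualTensorHomEquiv R Q Q)
  have : Module.Projective R (Module.End R P) := .of_equiv (dualTensorHomEquiv R P P)
  have : Module.Projective R (Module.End R Q) := .of_equiv (dualTensorHomEquiv R Q Q)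
  have h₂ := congrFun (Module.rankAtStalk_eq_of_equiv (M := A ⊗[R] Module.End R P)
    (N := C ⊗[R] Module.End R Q) θ.toLinearEquiv) p
  rw [Module.rankAtStalk_tensorProduct, Module.rankAtStalk_tensorProduct,
    show Module.rankAtStalk (R := R) (Module.End R P) = _ from rankAtStalk_linearMap P P,
    show Module.rankAtStalk (R := R) (Module.End R Q) = _ from rankAtStalk_linearMap Q Q] at h₂
  simp only [Pi.mul_apply, rankAtStalk_eq_degree_sq] at h₁ h₂
  have hP := rankAtStalk_pos_of_faithfulSMul P p
  have h₃ : degree R A p * Module.rankAtStalk P p = degree R C p * Module.rankAtStalk Q p := by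
    apply Nat.pow_left_injective two_ne_zero
    linear_combination h₂
  apply Nat.eq_of_mul_eq_mul_right hP
  rw [h₁, sq, mul_assoc, ← h₃]
  ring

/-! ### The index -/

theorem setGcd_eq {S : Set ℕ} {d : ℕ} (hd : d ∈ S) (hpos : 0 < d) (h : ∀ n ∈ S, d ∣ n) :
    setGcd S = d :=
  IsGreatest.csSup_eq ⟨h, fun _ hx => Nat.le_of_dvd hpos (hx d hd)⟩

theorem degree_eq_of_algEquiv {R : Type*} [CommRing R] {A B : Type*} [Ring A] [Algebra R A]
    [Ring B] [Algebra R B] (f : A ≃ₐ[R] B) (p : PrimeSpectrum R) :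
    degree R A p = degree R B p := by
  rw [degree, degree, Module.rankAtStalk_eq_of_equiv f.toLinearEquiv]

/-- The index is the degree of any Azumaya algebra in the Brauer class whose degree divides all
other degrees; such an algebra may live in any universe. -/
theorem index_eq_degree {R : Type u} [CommRing R] {A : Type*} [Ring A] [Algebra R A]
    {C : Type*} [Ring C] [Algebra R C] [IsAzumaya R C] (h : BrauerEquiv R A C)
    (p : PrimeSpectrum R)
    (hdvd : ∀ (B : Type u) [Ring B] [Algebra R B], IsAzumaya R B → BrauerEquiv R A B →
      degree R C p ∣ degree R B p) : index R A p = degree R C p := by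
  refine setGcd_eq ?_ (degree_pos C p) ?_
  · have : Small.{u} C := Module.Finite.small.{u} R C
    let f := (Shrink.algEquiv.{u} R C).symm
    exact ⟨Shrink.{u} C, inferInstance, inferInstance, .of_AlgEquiv R _ _ f, h.trans_algEquiv f,
      degree_eq_of_algEquiv f p⟩
  · rintro _ ⟨B, _, _, hB, hAB, rfl⟩
    exact hdvd B hB hAB

end AzumayaIndex

theorem mainTheorem10 (R : Type u) [CommRing R] [Finite (MaximalSpectrum R)]
    (A : Type v) [Ring A] [Algebra R A] [IsAzumaya R A] :
    ∃ (e : A) (he : IsIdempotentElem e),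
      AzumayaIndex.IsFull e ∧
      IsAzumaya R he.Corner ∧
      AzumayaIndex.BrauerEquiv R A he.Corner ∧
      ∀ p : PrimeSpectrum R,
        AzumayaIndex.reducedRank R A (AzumayaIndex.rightIdeal e) p =
            (AzumayaIndex.degree R he.Corner p : ℚ) ∧
        AzumayaIndex.degree R he.Corner p = AzumayaIndex.index R A p := by
  open AzumayaIndex in
  obtain ⟨e, he, hpos, hdvd⟩ :=
    exists_isIdempotentElem_rankAtStalk_dvd.{max u v} R A
  have hfull := isFull_of_rankAtStalk_pos he hpos
  have hC := isAzumaya_corner (R := R) he hfull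
  have hAC := brauerEquiv_corner (R := R) he hfull
  refine ⟨e, he, hfull, hC, hAC, fun p => ⟨?_, (index_eq_degree hAC p ?_).symm⟩⟩
  · have hA : (degree R A p : ℚ) ≠ 0 := Nat.cast_ne_zero.mpr (degree_pos A p).ne'
    rw [reducedRank, rankAtStalk_rightIdeal he hC, Nat.cast_mul, mul_div_cancel_left₀ _ hA]
  · intro B _ _ hB hAB
    obtain ⟨W, _, _, _, _, _, _, hW⟩ := hAB.exists_module
    have := finite_rightIdeal (R := R) he
    have := projective_rightIdeal_base (R := R) he
    have : IsAzumaya R Aᵐᵒᵖ := isAzumaya_mulOpposite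
    have := projective_of_projective_algebra (R := R) Aᵐᵒᵖ W
    obtain ⟨m, hm, hpm⟩ := p.asIdeal.exists_le_maximal p.isPrime.ne_top
    have h := hdvd W ⟨m, hm⟩
    -- ranks at `p` agree with the ranks at a maximal ideal containing `p`
    rw [← Module.rankAtStalk_eq_of_le_of_finite_of_flat (rightIdeal e) (p := p) hpm,
      ← Module.rankAtStalk_eq_of_le_of_finite_of_flat W (p := p) hpm,
      rankAtStalk_rightIdeal he hC, hW] at h
    exact Nat.dvd_of_mul_dvd_mul_left (degree_pos A p) h
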